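/- Fix real numbers $0 \le \gamma < \delta \le 1$ and an integer $r \ge 0$. For $n \ge 1$ let $X^{(n)}$ be the number of cycles with length in the interval $[\gamma n, \delta n]$ (fixed points being cycles of length $1$) of a permutation of $\{1, \ldots, n\}$ chosen uniformly at random, and write $(x)_r = x(x-1)\cdots(x-r+1)$, with $(x)_0 = 1$. Then $$\lim_{n \to \infty} \mathbb{E}\bigl[(X^{(n)})_r\bigr] = \int_{\substack{z_1 + \cdots + z_r \le 1 \\ z_1, \ldots, z_r \in [\gamma, \delta]}} \frac{1}{z_1 \cdots z_r} \, dz_1 \cdots dz_r ,$$ where the limit and the Lebesgue integral are taken in $[0, \infty]$, and the integral over the one-point space is $1$ when $r = 0$. If $\gamma > 0$, the integral is finite and the limit holds in $\mathbb{R}$. -/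

import Mathlib

open scoped BigOperators

namespace RandomPermutation

/-- The number of cycles of the permutation `σ` of an `n`-element set whose length lies in
`[γ n, δ n]`. The parts of `σ.partition` are the lengths of all cycles of `σ`, with multiplicity,
fixed points being counted as cycles of length `1`. -/
noncomputable def cycleCount (γ δ : ℝ) {n : ℕ} (σ : Equiv.Perm (Fin n)) : ℕ :=
  σ.partition.parts.countP (fun k : ℕ => γ * n ≤ k ∧ k ≤ δ * n)

/-- The `r`-th factorial moment of the number of cycles with length in `[γ n, δ n]`, that is, the
expectation of `X (X - 1) ⋯ (X - r + 1)` over a uniformly random permutation of `Fin n`. -/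
noncomputable def factorialMoment (γ δ : ℝ) (r n : ℕ) : ℝ :=
  𝔼 σ : Equiv.Perm (Fin n), ((cycleCount γ δ σ).descFactorial r : ℝ)

/-- The part of the cube `[γ, δ] ^ r` where the sum of the coordinates is at most `1`. -/
def slicedCube (γ δ : ℝ) (r : ℕ) : Set (Fin r → ℝ) :=
  {z | (∀ i, z i ∈ Set.Icc γ δ) ∧ ∑ i, z i ≤ 1}

end RandomPermutation

/-!
For a random permutation of `n` points, the probability of the cycle lengths forming a given
partition is `1 / ∏ k ^ mₖ * mₖ!` (Cauchy's formula, `card_partition_eq`). Replacing a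
partition with a part `k` by the partition left after removing `k` multiplies this weight by
`k * mₖ`. So marking a cycle of length `k` gives the recursion `partsMoment_succ` for factorial
moments, and iterating it gives the exact formula `factorialMoment_eq_sum`:
`𝔼 (X)_r = ∑ 1 / (k₁ ⋯ k_r)`, over all `r`-tuples of integers in `[γ n, δ n]` that are positive
and have sum at most `n`.

If `γ > 0`, this sum is the Riemann sum over the points of `n⁻¹ ℤ ^ r` in the sliced cube for the
function `1 / (z₁ ⋯ z_r)` (`factorialMoment_eq_riemannSum`). The sliced cube is compact and convex,
hence has a null boundary, and the function is continuous on it, so the Riemann sums converge to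
the integral (`tendsto_factorialMoment`).

If `γ = 0` and `r ≥ 1`, both sides are infinite: the sum dominates the `r`-th power of a harmonic
sum of length about `δ n / r` (`tendsto_factorialMoment_zero_left`), and the integral is at least
an infinite sum of equal contributions of dyadic cubes (`lintegral_slicedCube_zero_left`).
If `r = 0`, both sides are `1`.
-/

namespace RandomPermutation

open Finset Nat MeasureTheory
open scoped Pointwise Topology

/-! ### The cycle type of a uniformly random permutation -/

/-- The probability `1 / ∏ k ^ mₖ * mₖ!` that a uniformly random permutation of a set with
`m.sum` elements has cycle lengths `m`, where `mₖ` is the multiplicity of `k` in `m`. -/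
noncomputable def cycleWeight (m : Multiset ℕ) : ℝ :=
  ((m.prod * ∏ i ∈ m.toFinset, (m.count i)! : ℕ) : ℝ)⁻¹

lemma prod_factorial_count_of_subset {m : Multiset ℕ} {s : Finset ℕ} (h : m.toFinset ⊆ s) :
    ∏ i ∈ m.toFinset, (m.count i)! = ∏ i ∈ s, (m.count i)! := by
  refine prod_subset h fun i _ hi => ?_
  rw [Multiset.mem_toFinset] at hi
  simp [Multiset.count_eq_zero.2 hi]

lemma cycleWeight_cons_mul_count {k : ℕ} (m : Multiset ℕ) :
    cycleWeight (k ::ₘ m) * (m.count k + 1 : ℕ) = cycleWeight m / k := by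
  have key : ∏ i ∈ (k ::ₘ m).toFinset, ((k ::ₘ m).count i)! =
      (m.count k + 1) * ∏ i ∈ m.toFinset, (m.count i)! := by
    rw [prod_factorial_count_of_subset (m := m) (s := (k ::ₘ m).toFinset)
      (fun i hi => by simp_all)]
    have hk : k ∈ (k ::ₘ m).toFinset := by simp
    rw [← mul_prod_erase _ _ hk, ← mul_prod_erase _ _ hk, ← mul_assoc]
    congr 1
    · simp [Nat.factorial_succ]
    · refine prod_congr rfl fun i hi => ?_
      rw [Multiset.count_cons_of_ne (ne_of_mem_erase hi)]
  rw [cycleWeight, cycleWeight, key, Multiset.prod_cons]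
  push_cast
  have : ((m.count k : ℝ) + 1) ≠ 0 := by positivity
  simp only [mul_inv, div_eq_mul_inv]
  field_simp

variable {α : Type*} [DecidableEq α] [Fintype α]

lemma parts_eq_filter_add_replicate {n : ℕ} (l : n.Partition) :
    l.parts = l.parts.filter (2 ≤ ·) +
      Multiset.replicate (n - (l.parts.filter (2 ≤ ·)).sum) 1 := by
  obtain ⟨c, hc⟩ : ∃ c, l.parts.filter (fun i => ¬ 2 ≤ i) = Multiset.replicate c 1 := by
    refine ⟨_, Multiset.eq_replicate_card.2 fun i hi => ?_⟩
    rw [Multiset.mem_filter] at hi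
    have := l.parts_pos hi.1
    omega
  have h := Multiset.filter_add_not (2 ≤ ·) l.parts
  have hs := congrArg Multiset.sum h
  rw [hc, Multiset.sum_add, l.parts_sum, Multiset.sum_replicate, smul_eq_mul, mul_one] at hs
  have hcard : n - (l.parts.filter (2 ≤ ·)).sum = c := by omega
  rw [hcard]
  conv_lhs => rw [← h, hc]

/-- `Equiv.Perm.cycleType` omits the fixed points; their number is determined by the other cycle
lengths, so they carry no further information. -/
lemma partition_eq_iff_cycleType_eq (σ : Equiv.Perm α) (l : (Fintype.card α).Partition) :
    σ.partition = l ↔ σ.cycleType = l.parts.filter (2 ≤ ·) := by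
  constructor
  · rintro rfl
    exact Equiv.Perm.filter_parts_partition_eq_cycleType.symm
  · intro h
    apply Nat.Partition.ext
    rw [Equiv.Perm.parts_partition, ← Equiv.Perm.sum_cycleType, h,
      ← parts_eq_filter_add_replicate]

/-- Cauchy's formula for the number of permutations with prescribed cycle lengths. -/
lemma card_partition_eq (l : (Fintype.card α).Partition) :
    (#{σ : Equiv.Perm α | σ.partition = l} : ℝ) = (Fintype.card α)! * cycleWeight l.parts := by
  simp only [partition_eq_iff_cycleType_eq]
  have hl := parts_eq_filter_add_replicate l
  set m := l.parts.filter (2 ≤ ·) with hm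
  have hm2 : ∀ a ∈ m, 2 ≤ a := fun a ha => (Multiset.mem_filter.1 ha).2
  have hsum : m.sum ≤ Fintype.card α := by
    conv_rhs => rw [← l.parts_sum, hl]
    simp
  have hcard := Equiv.Perm.card_of_cycleType_mul_eq α m
  rw [if_pos ⟨hsum, hm2⟩] at hcard
  have hone : 1 ∉ m.toFinset := fun h => by
    have := hm2 1 (Multiset.mem_toFinset.1 h)
    omega
  have hprod : ∏ i ∈ l.parts.toFinset, (l.parts.count i)! =
      (Fintype.card α - m.sum)! * ∏ i ∈ m.toFinset, (m.count i)! := by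
    rw [prod_factorial_count_of_subset (s := insert 1 m.toFinset), prod_insert hone]
    · congr 1
      · rw [hl, Multiset.count_add, Multiset.count_replicate_self,
          Multiset.count_eq_zero.2 (by simpa using hone), zero_add]
      · refine prod_congr rfl fun i hi => ?_
        have : 1 ≠ i := fun h => hone (h ▸ hi)
        rw [hl, Multiset.count_add, Multiset.count_replicate, if_neg this, add_zero]
    · intro i hi
      rw [hl] at hi
      simp only [Multiset.mem_toFinset, Multiset.mem_add, Multiset.mem_replicate] at hi
      simp only [mem_insert, Multiset.mem_toFinset]
      tauto
  have hparts : l.parts.prod = m.prod := by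
    rw [hl]
    simp
  have hpos : 0 < m.prod := Multiset.prod_pos fun a ha => zero_lt_two.trans_le (hm2 a ha)
  have hpos' : 0 < ∏ i ∈ m.toFinset, (m.count i)! := prod_pos fun i _ => Nat.factorial_pos _
  rw [cycleWeight, hprod, hparts, ← hcard, eq_comm, ← div_eq_mul_inv, div_eq_iff (by positivity)]
  push_cast
  ring

lemma expect_partition (f : (Fintype.card α).Partition → ℝ) :
    𝔼 σ : Equiv.Perm α, f σ.partition = ∑ l, cycleWeight l.parts * f l := by
  rw [Fintype.expect_eq_sum_div_card, Fintype.card_perm,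
    ← sum_fiberwise (s := univ) (g := fun σ : Equiv.Perm α => σ.partition), sum_div]
  refine sum_congr rfl fun l _ => ?_
  rw [sum_congr rfl (g := fun _ => f l) (fun σ hσ => by rw [(mem_filter.1 hσ).2]), sum_const,
    nsmul_eq_mul, card_partition_eq]
  field_simp

/-! ### Factorial moments as sums over tuples of cycle lengths -/

/-- The `r`-th factorial moment of the number of parts satisfying `p`, for a partition of `n`
distributed as the cycle lengths of a uniformly random permutation. -/
noncomputable def partsMoment (p : ℕ → Prop) [DecidablePred p] (r n : ℕ) : ℝ :=
  ∑ l : n.Partition, cycleWeight l.parts * ((l.parts.countP p).descFactorial r : ℝ)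

lemma factorialMoment_eq_partsMoment (γ δ : ℝ) (r n : ℕ) :
    factorialMoment γ δ r n =
      partsMoment (fun k : ℕ => γ * n ≤ k ∧ k ≤ δ * n) r n := by
  have h := expect_partition (α := Fin n) fun l =>
    ((l.parts.countP (fun k : ℕ => γ * n ≤ k ∧ k ≤ δ * n)).descFactorial r : ℝ)
  have h2 : factorialMoment γ δ r n =
      partsMoment (fun k : ℕ => γ * n ≤ k ∧ k ≤ δ * n) r (Fintype.card (Fin n)) := h
  rwa [Fintype.card_fin] at h2

lemma countP_parts_eq_sum_count (p : ℕ → Prop) [DecidablePred p] {n : ℕ} (l : n.Partition) :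
    l.parts.countP p = ∑ k ∈ Icc 1 n with p k, l.parts.count k := by
  rw [Multiset.countP_eq_card_filter, ← Multiset.toFinset_sum_count_eq]
  have hsub : (l.parts.filter p).toFinset ⊆ {k ∈ Icc 1 n | p k} := by
    intro k hk
    rw [Multiset.mem_toFinset, Multiset.mem_filter] at hk
    exact mem_filter.2 ⟨mem_Icc.2 ⟨l.parts_pos hk.1, l.le_of_mem_parts hk.1⟩, hk.2⟩
  rw [sum_subset hsub fun k _ hk => Multiset.count_eq_zero.2 (by simpa using hk)]
  exact sum_congr rfl fun k hk => Multiset.count_filter_of_pos (mem_filter.1 hk).2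

lemma partsMoment_zero (p : ℕ → Prop) [DecidablePred p] (n : ℕ) : partsMoment p 0 n = 1 := by
  have h := expect_partition (α := Fin n) fun _ => 1
  rw [Fintype.expect_eq_sum_div_card, Fintype.card_perm, Fintype.card_fin] at h
  simpa [partsMoment, Fintype.card_perm, Nat.factorial_ne_zero] using h.symm

/-- Marking one of the counted cycles, of length `k`, leaves a random permutation of `n - k`
points. -/
lemma partsMoment_succ (p : ℕ → Prop) [DecidablePred p] (r n : ℕ) :
    partsMoment p (r + 1) n = ∑ k ∈ Icc 1 n with p k, partsMoment p r (n - k) / k := by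
  -- When no part is counted, the truncated `countP p - 1` is harmless: all counts `count k` vanish.
  have h1 : ∀ l : n.Partition,
      cycleWeight l.parts * ((l.parts.countP p).descFactorial (r + 1) : ℝ) =
        ∑ k ∈ Icc 1 n with p k, cycleWeight l.parts * l.parts.count k *
          ((l.parts.countP p - 1).descFactorial r : ℝ) := by
    intro l
    have : (l.parts.countP p).descFactorial (r + 1) =
        l.parts.countP p * (l.parts.countP p - 1).descFactorial r := by
      cases l.parts.countP p with
      | zero => simp
      | succ c => rw [Nat.succ_descFactorial_succ, Nat.add_sub_cancel]
    rw [this, ← sum_mul, ← mul_sum]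
    conv_lhs => rw [Nat.cast_mul, countP_parts_eq_sum_count p l]
    push_cast
    rw [countP_parts_eq_sum_count p l]
    ring
  rw [partsMoment, sum_congr rfl fun l _ => h1 l, sum_comm]
  refine sum_congr rfl fun k hk => ?_
  obtain ⟨hk, hpk⟩ := mem_filter.1 hk
  obtain ⟨hk1, hkn⟩ := mem_Icc.1 hk
  -- Only partitions with a part `k` contribute, and removing that part is a bijection.
  rw [← sum_filter_of_ne (p := fun l : n.Partition => k ∈ l.parts),
    sum_subtype _ (p := fun l : n.Partition => k ∈ l.parts) (by simp),
    ← Equiv.sum_comp (Nat.Partition.partitionWithPartEquiv hk1 hkn).symm, partsMoment, sum_div]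
  · refine sum_congr rfl fun l _ => ?_
    rw [Nat.Partition.partitionWithPartEquiv_symm_apply_parts, Multiset.count_cons_self,
      cycleWeight_cons_mul_count, Multiset.countP_cons_of_pos _ hpk, Nat.add_sub_cancel]
    ring
  · intro l _ hl
    by_contra hkl
    simp [Multiset.count_eq_zero.2 hkl] at hl

/-- The ordered `r`-tuples of positive integers satisfying `p` whose sum is at most `n`. -/
def lengthTuples (p : ℕ → Prop) [DecidablePred p] (r n : ℕ) : Finset (Fin r → ℕ) :=
  {k ∈ Fintype.piFinset fun _ => Icc 1 n | (∀ i, p (k i)) ∧ ∑ i, k i ≤ n}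

lemma mem_lengthTuples {p : ℕ → Prop} [DecidablePred p] {r n : ℕ} {k : Fin r → ℕ} :
    k ∈ lengthTuples p r n ↔ (∀ i, 1 ≤ k i ∧ p (k i)) ∧ ∑ i, k i ≤ n := by
  simp only [lengthTuples, mem_filter, Fintype.mem_piFinset, mem_Icc]
  constructor
  · rintro ⟨h1, h2, h3⟩
    exact ⟨fun i => ⟨(h1 i).1, h2 i⟩, h3⟩
  · rintro ⟨h1, h2⟩
    exact ⟨fun i => ⟨(h1 i).1, (single_le_sum (fun _ _ => Nat.zero_le _) (mem_univ i)).trans h2⟩,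
      fun i => (h1 i).2, h2⟩

/-- Summing over the first entry of a tuple reproduces the recursion `partsMoment_succ`. -/
lemma partsMoment_eq_sum_lengthTuples (p : ℕ → Prop) [DecidablePred p] (r n : ℕ) :
    partsMoment p r n = ∑ k ∈ lengthTuples p r n, ∏ i, (k i : ℝ)⁻¹ := by
  induction r generalizing n with
  | zero =>
    have : lengthTuples p 0 n = univ := by
      ext k
      simp [mem_lengthTuples]
      exact Subsingleton.elim _ _
    simp [partsMoment_zero, this]
  | succ r ih =>
    simp only [partsMoment_succ, ih, sum_div]
    rw [sum_sigma']
    refine sum_bij' (fun x _ => (Fin.cons x.1 x.2 : Fin (r + 1) → ℕ))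
      (fun k _ => ⟨k 0, Fin.tail k⟩) ?_ ?_ ?_ ?_ ?_
    · rintro ⟨a, k⟩ h
      simp only [mem_sigma, mem_filter, mem_Icc, mem_lengthTuples] at h
      simp only [mem_lengthTuples, Fin.forall_fin_succ, Fin.cons_zero, Fin.cons_succ,
        Fin.sum_univ_succ]
      exact ⟨⟨⟨h.1.1.1, h.1.2⟩, h.2.1⟩, by omega⟩
    · intro k h
      simp only [mem_lengthTuples, Fin.forall_fin_succ, Fin.sum_univ_succ] at h
      simp only [mem_sigma, mem_filter, mem_Icc, mem_lengthTuples, Fin.tail]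
      exact ⟨⟨⟨h.1.1.1, by omega⟩, h.1.1.2⟩, h.1.2, by omega⟩
    · rintro ⟨a, k⟩ _
      simp
    · intro k _
      simp
    · rintro ⟨a, k⟩ _
      simp [Fin.prod_univ_succ, div_eq_mul_inv, mul_comm]

lemma factorialMoment_eq_sum (γ δ : ℝ) (r n : ℕ) :
    factorialMoment γ δ r n =
      ∑ k ∈ lengthTuples (fun k : ℕ => γ * n ≤ k ∧ k ≤ δ * n) r n, ∏ i, (k i : ℝ)⁻¹ := by
  rw [factorialMoment_eq_partsMoment, partsMoment_eq_sum_lengthTuples]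

/-! ### Riemann sums over the sliced cube -/

lemma convex_slicedCube (γ δ : ℝ) (r : ℕ) : Convex ℝ (slicedCube γ δ r) := by
  rintro x ⟨hx, hx1⟩ y ⟨hy, hy1⟩ a b ha hb hab
  refine ⟨fun i => convex_Icc γ δ (hx i) (hy i) ha hb hab, ?_⟩
  simp only [Pi.add_apply, Pi.smul_apply, smul_eq_mul, sum_add_distrib, ← mul_sum]
  nlinarith

lemma isClosed_slicedCube (γ δ : ℝ) (r : ℕ) : IsClosed (slicedCube γ δ r) := by
  have : slicedCube γ δ r = (⋂ i, {z : Fin r → ℝ | z i ∈ Set.Icc γ δ}) ∩ {z | ∑ i, z i ≤ 1} := by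
    ext z
    simp [slicedCube]
  rw [this]
  exact (isClosed_iInter fun i => isClosed_Icc.preimage (continuous_apply i)).inter
    (isClosed_le (by fun_prop) continuous_const)

lemma isBounded_slicedCube (γ δ : ℝ) (r : ℕ) : Bornology.IsBounded (slicedCube γ δ r) := by
  refine (Metric.isBounded_Icc (fun _ => γ : Fin r → ℝ) fun _ => δ).subset fun z hz => ?_
  exact ⟨fun i => (hz.1 i).1, fun i => (hz.1 i).2⟩

lemma isCompact_slicedCube (γ δ : ℝ) (r : ℕ) : IsCompact (slicedCube γ δ r) :=
  Metric.isCompact_of_isClosed_isBounded (isClosed_slicedCube γ δ r) (isBounded_slicedCube γ δ r)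

/-- A continuous function on the whole space that agrees with `z ↦ 1 / ∏ i, z i` on the
sliced cube when `γ > 0`. -/
noncomputable def truncatedInvProd (γ : ℝ) {r : ℕ} (z : Fin r → ℝ) : ℝ := ∏ i, (max (z i) γ)⁻¹

lemma continuous_truncatedInvProd {γ : ℝ} (hγ : 0 < γ) (r : ℕ) :
    Continuous (truncatedInvProd γ : (Fin r → ℝ) → ℝ) := by
  refine continuous_finsetProd _ fun i _ => ?_
  exact ((continuous_apply i).max continuous_const).inv₀ fun z => (lt_max_of_lt_right hγ).ne'

lemma truncatedInvProd_eq {γ δ : ℝ} {r : ℕ} {z : Fin r → ℝ} (hz : z ∈ slicedCube γ δ r) :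
    truncatedInvProd γ z = 1 / ∏ i, z i := by
  rw [truncatedInvProd, one_div, ← prod_inv_distrib]
  exact prod_congr rfl fun i _ => by rw [max_eq_left (hz.1 i).1]

lemma integrableOn_slicedCube {γ : ℝ} (hγ : 0 < γ) (δ : ℝ) (r : ℕ) :
    IntegrableOn (fun z : Fin r → ℝ => 1 / ∏ i, z i) (slicedCube γ δ r) :=
  ((continuous_truncatedInvProd hγ r).continuousOn.integrableOn_compact
    (isCompact_slicedCube γ δ r)).congr_fun (fun _ hz => truncatedInvProd_eq hz)
      (isClosed_slicedCube γ δ r).measurableSet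

lemma div_mem_slicedCube_iff {γ δ : ℝ} {r n : ℕ} (hn : 0 < n) (k : Fin r → ℕ) :
    (fun i => (k i : ℝ) / n) ∈ slicedCube γ δ r ↔
      (∀ i, γ * n ≤ k i ∧ k i ≤ δ * n) ∧ ∑ i, k i ≤ n := by
  have hn' : (0 : ℝ) < n := by exact_mod_cast hn
  simp only [slicedCube, Set.mem_ofPred_eq, Set.mem_Icc, ← sum_div, le_div_iff₀ hn',
    div_le_iff₀ hn', one_mul]
  norm_cast

/-- For `γ > 0` the factorial moment is exactly the Riemann sum of `1 / ∏ i, z i` over the points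
of `n⁻¹ ℤ ^ r` in the sliced cube. -/
lemma factorialMoment_eq_riemannSum {γ δ : ℝ} (hγ : 0 < γ) (r : ℕ) {n : ℕ} (hn : 0 < n) :
    factorialMoment γ δ r n =
      (∑' x : ↑(slicedCube γ δ r ∩
        (n : ℝ)⁻¹ • (Submodule.span ℤ (Set.range (Pi.basisFun ℝ (Fin r))) : Set (Fin r → ℝ))),
          truncatedInvProd γ (x : Fin r → ℝ)) / (n : ℝ) ^ Fintype.card (Fin r) := by
  have : NeZero n := ⟨hn.ne'⟩
  have hn' : (0 : ℝ) < n := by exact_mod_cast hn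
  set S := slicedCube γ δ r ∩
    (n : ℝ)⁻¹ • (Submodule.span ℤ (Set.range (Pi.basisFun ℝ (Fin r))) : Set (Fin r → ℝ)) with hS
  set T := lengthTuples (fun k : ℕ => γ * n ≤ k ∧ k ≤ δ * n) r n with hT
  have hTmem : ∀ k : Fin r → ℕ, k ∈ T ↔ (fun i => (k i : ℝ) / n) ∈ slicedCube γ δ r := by
    intro k
    -- Positivity of the entries is automatic, since `γ n > 0`.
    rw [hT, mem_lengthTuples, div_mem_slicedCube_iff hn]
    refine and_congr_left fun _ => forall_congr' fun i => and_iff_right_of_imp fun h => ?_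
    have : (0 : ℝ) < k i := (mul_pos hγ hn').trans_le h.1
    exact_mod_cast this
  have hmem : ∀ k : T, (fun i => (k.1 i : ℝ) / n) ∈ S := by
    intro k
    refine ⟨(hTmem k).1 k.2, BoxIntegral.unitPartition.mem_smul_span_iff.2 fun i => ⟨k.1 i, ?_⟩⟩
    simp
    field_simp
  let e : T → S := fun k => ⟨fun i => (k.1 i : ℝ) / n, hmem k⟩
  have he : Function.Bijective e := by
    constructor
    · intro k l hkl
      ext i
      have := congrFun (congrArg Subtype.val hkl) i
      simpa [e, hn'.ne', div_left_inj'] using this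
    · rintro ⟨z, hz, hzL⟩
      have hzL := BoxIntegral.unitPartition.mem_smul_span_iff.1 hzL
      have hex : ∀ i, ∃ k : ℕ, (k : ℝ) / n = z i := by
        intro i
        obtain ⟨a, ha⟩ := hzL i
        have ha' : (a : ℝ) = n * z i := ha
        have h0 : 0 ≤ a := by
          have : (0 : ℝ) ≤ a := ha' ▸ mul_nonneg hn'.le (hγ.le.trans (hz.1 i).1)
          exact_mod_cast this
        lift a to ℕ using h0
        exact ⟨a, by rw [div_eq_iff hn'.ne', mul_comm]; exact_mod_cast ha'⟩
      choose k hk using hex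
      have hkz : (fun i => (k i : ℝ) / n) = z := funext hk
      exact ⟨⟨k, (hTmem k).2 (hkz ▸ hz)⟩, Subtype.ext hkz⟩
  rw [← (Equiv.ofBijective e he).tsum_eq, factorialMoment_eq_sum, ← hT, tsum_fintype,
    ← sum_coe_sort T, sum_div, Fintype.card_fin]
  refine sum_congr rfl fun k _ => ?_
  have hk := truncatedInvProd_eq ((hTmem k).1 k.2)
  simp only [Equiv.ofBijective_apply, e, hk, prod_div_distrib, prod_inv_distrib, prod_const,
    Finset.card_univ, Fintype.card_fin]
  field_simp

theorem tendsto_factorialMoment {γ : ℝ} (hγ : 0 < γ) (δ : ℝ) (r : ℕ) :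
    Filter.Tendsto (fun n : ℕ => factorialMoment γ δ r n) Filter.atTop
      (𝓝 (∫ z in slicedCube γ δ r, 1 / ∏ i, z i)) := by
  rw [← setIntegral_congr_fun (isClosed_slicedCube γ δ r).measurableSet
    fun z hz => truncatedInvProd_eq hz]
  refine (tendsto_tsum_div_pow_atTop_integral _ _ (continuous_truncatedInvProd hγ r)
    (isBounded_slicedCube γ δ r) (isClosed_slicedCube γ δ r).measurableSet
    ((convex_slicedCube γ δ r).addHaar_frontier _)).congr' ?_
  filter_upwards [Filter.eventually_gt_atTop 0] with n hn
  exact (factorialMoment_eq_riemannSum hγ r hn).symm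

/-! ### Divergence when the interval reaches zero -/

lemma tendsto_factorialMoment_zero_left {δ : ℝ} (hδ0 : 0 < δ) (hδ : δ ≤ 1) {r : ℕ} (hr : r ≠ 0) :
    Filter.Tendsto (fun n : ℕ => factorialMoment 0 δ r n) Filter.atTop Filter.atTop := by
  have hr' : (1 : ℝ) ≤ r := by exact_mod_cast Nat.one_le_iff_ne_zero.2 hr
  have hr0 : (0 : ℝ) < r := by linarith
  have hM : Filter.Tendsto (fun n : ℕ => ⌊δ / r * n⌋₊) Filter.atTop Filter.atTop :=
    tendsto_nat_floor_atTop.comp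
      (tendsto_natCast_atTop_atTop.const_mul_atTop (by positivity))
  refine Filter.tendsto_atTop_mono (fun n => ?_)
    ((Filter.tendsto_pow_atTop hr).comp (Real.tendsto_sum_range_one_div_nat_succ_atTop.comp hM))
  -- Tuples whose entries are all at most `δ n / r` satisfy every constraint.
  set M := ⌊δ / r * n⌋₊ with hMdef
  have hMle : r * (M : ℝ) ≤ δ * n := by
    have := Nat.floor_le (show 0 ≤ δ / r * n by positivity)
    rw [← hMdef, div_mul_eq_mul_div, le_div_iff₀ hr0] at this
    linarith
  rw [factorialMoment_eq_sum]
  have hharm : ∀ m : ℕ, ∑ i ∈ range m, 1 / ((i : ℝ) + 1) = ∑ k ∈ Icc 1 m, (k : ℝ)⁻¹ := by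
    intro m
    induction m with
    | zero => simp
    | succ m ih =>
      rw [sum_range_succ, sum_Icc_succ_top (by omega), ih]
      simp
  have hpow : (∑ k ∈ Icc 1 M, (k : ℝ)⁻¹) ^ r =
      ∑ k ∈ Fintype.piFinset fun _ : Fin r => Icc 1 M, ∏ i, (k i : ℝ)⁻¹ := by
    rw [sum_prod_piFinset (Icc 1 M) fun (_ : Fin r) (k : ℕ) => (k : ℝ)⁻¹]
    simp
  simp only [Function.comp]
  rw [hharm, hpow]
  refine sum_le_sum_of_subset_of_nonneg (fun k hk => ?_)
    fun k _ _ => prod_nonneg fun i _ => by positivity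
  simp only [Fintype.mem_piFinset, mem_Icc] at hk
  have hMn : (M : ℝ) ≤ δ * n := by nlinarith [Nat.cast_nonneg (α := ℝ) M]
  refine mem_lengthTuples.2 ⟨fun i => ⟨(hk i).1, by simp, ?_⟩, ?_⟩
  · exact le_trans (by exact_mod_cast (hk i).2) hMn
  · have hsum : ∑ i, k i ≤ r * M := by
      simpa using sum_le_card_nsmul univ k M fun i _ => (hk i).2
    have hrM : (r * M : ℕ) ≤ (n : ℝ) := by
      push_cast
      nlinarith [Nat.cast_nonneg (α := ℝ) n]
    exact hsum.trans (by exact_mod_cast hrM)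

/-- The dyadic cubes `(δ / (r 2 ^ (j + 1)), δ / (r 2 ^ j)] ^ r` are disjoint subsets of
`slicedCube 0 δ r`, and by scaling each contributes at least `2 ^ (-r)` to the integral. -/
lemma lintegral_slicedCube_zero_left {δ : ℝ} (hδ0 : 0 < δ) (hδ : δ ≤ 1) {r : ℕ} (hr : r ≠ 0) :
    ∫⁻ z in slicedCube 0 δ r, ENNReal.ofReal (1 / ∏ i, z i) = ⊤ := by
  have hr' : (1 : ℝ) ≤ r := by exact_mod_cast Nat.one_le_iff_ne_zero.2 hr
  have hr0 : (0 : ℝ) < r := by linarith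
  set a : ℕ → ℝ := fun j => δ / r * (1 / 2) ^ j with ha
  have ha0 : ∀ j, 0 < a j := fun j => by positivity
  have hsucc : ∀ j, a (j + 1) = a j / 2 := fun j => by
    simp only [ha, pow_succ]
    ring
  have hanti : Antitone a := antitone_nat_of_succ_le fun j => by
    rw [hsucc]
    linarith [ha0 j]
  have hale : ∀ j, a j ≤ δ / r := fun j => by
    simpa [ha] using hanti (Nat.zero_le j)
  set B : ℕ → Set (Fin r → ℝ) := fun j => Set.univ.pi fun _ => Set.Ioc (a (j + 1)) (a j) with hB
  have hBmeas : ∀ j, MeasurableSet (B j) := fun j =>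
    MeasurableSet.univ_pi fun _ => measurableSet_Ioc
  have hBsub : ⋃ j, B j ⊆ slicedCube 0 δ r := by
    refine Set.iUnion_subset fun j z hz => ?_
    have hz' : ∀ i, a (j + 1) < z i ∧ z i ≤ a j := fun i => hz i trivial
    refine ⟨fun i => ⟨(ha0 _).le.trans (hz' i).1.le, ?_⟩, ?_⟩
    · exact ((hz' i).2.trans (hale j)).trans (div_le_self hδ0.le hr')
    · have := sum_le_card_nsmul univ z (δ / r) fun i _ => (hz' i).2.trans (hale j)
      rw [Finset.card_univ, Fintype.card_fin, nsmul_eq_mul, mul_div_cancel₀ _ hr0.ne'] at this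
      exact this.trans hδ
  have hdisj : Pairwise (Function.onFun Disjoint B) := by
    intro i j hij
    refine Set.disjoint_left.2 fun z hzi hzj => ?_
    let i₀ : Fin r := ⟨0, Nat.pos_of_ne_zero hr⟩
    exact Set.disjoint_left.1 (hanti.pairwise_disjoint_on_Ioc_succ hij) (hzi i₀ trivial)
      (hzj i₀ trivial)
  have hlower : ∀ j, ENNReal.ofReal ((1 / 2) ^ r) ≤
      ∫⁻ z in B j, ENNReal.ofReal (1 / ∏ i, z i) := by
    intro j
    calc ENNReal.ofReal ((1 / 2) ^ r)
        = ENNReal.ofReal (1 / a j ^ r) * volume (B j) := by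
          rw [hB, Real.volume_pi_Ioc, ← ENNReal.ofReal_prod_of_nonneg, ← ENNReal.ofReal_mul]
          · congr 1
            have := (ha0 j).ne'
            simp only [prod_const, Finset.card_univ, Fintype.card_fin, hsucc, sub_half]
            rw [div_pow, div_pow, one_pow]
            field_simp
          · have := ha0 j
            positivity
          · intro i _
            rw [hsucc]
            linarith [ha0 j]
      _ = ∫⁻ _ in B j, ENNReal.ofReal (1 / a j ^ r) := (setLIntegral_const _ _).symm
      _ ≤ ∫⁻ z in B j, ENNReal.ofReal (1 / ∏ i, z i) := by
          refine setLIntegral_mono' (hBmeas j) fun z hz => ENNReal.ofReal_le_ofReal ?_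
          have hz' : ∀ i, a (j + 1) < z i ∧ z i ≤ a j := fun i => hz i trivial
          have hz0 : ∀ i, 0 < z i := fun i => (ha0 _).trans (hz' i).1
          refine one_div_le_one_div_of_le (prod_pos fun i _ => hz0 i) ?_
          calc ∏ i, z i ≤ ∏ _i : Fin r, a j :=
                prod_le_prod (fun i _ => (hz0 i).le) fun i _ => (hz' i).2
            _ = a j ^ r := by simp
  refine top_unique ?_
  calc (⊤ : ENNReal) = ∑' _ : ℕ, ENNReal.ofReal ((1 / 2) ^ r) :=
        (ENNReal.tsum_const_eq_top_of_ne_zero (by simp)).symm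
    _ ≤ ∑' j, ∫⁻ z in B j, ENNReal.ofReal (1 / ∏ i, z i) := ENNReal.tsum_le_tsum hlower
    _ = ∫⁻ z in ⋃ j, B j, ENNReal.ofReal (1 / ∏ i, z i) :=
        (lintegral_iUnion hBmeas hdisj _).symm
    _ ≤ _ := lintegral_mono_set hBsub

/-! ### The zeroth moment, and the limit in general -/

lemma factorialMoment_zero (γ δ : ℝ) (n : ℕ) : factorialMoment γ δ 0 n = 1 := by
  rw [factorialMoment_eq_partsMoment, partsMoment_zero]

lemma slicedCube_zero (γ δ : ℝ) : slicedCube γ δ 0 = Set.univ := by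
  ext z
  simp [slicedCube]

end RandomPermutation

open RandomPermutation in
/-- The first part compares both sides in `[0, ∞]`, which covers `γ = 0`, where they are infinite
as soon as `r ≥ 1`; the second part is the same limit formula in `ℝ` when `γ > 0`. -/
theorem mainTheorem2 (γ δ : ℝ) (hγ : 0 ≤ γ) (hγδ : γ < δ) (hδ : δ ≤ 1) (r : ℕ) :
    Filter.Tendsto
        (fun n : ℕ => ENNReal.ofReal (RandomPermutation.factorialMoment γ δ r n))
        Filter.atTop
        (nhds (∫⁻ z in RandomPermutation.slicedCube γ δ r, ENNReal.ofReal (1 / ∏ i, z i))) ∧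
      (0 < γ →
        MeasureTheory.IntegrableOn (fun z : Fin r → ℝ => 1 / ∏ i, z i)
            (RandomPermutation.slicedCube γ δ r) ∧
          Filter.Tendsto
            (fun n : ℕ => RandomPermutation.factorialMoment γ δ r n)
            Filter.atTop
            (nhds (∫ z in RandomPermutation.slicedCube γ δ r, 1 / ∏ i, z i))) := by
  have hpos : 0 < γ →
      MeasureTheory.IntegrableOn (fun z : Fin r → ℝ => 1 / ∏ i, z i) (slicedCube γ δ r) ∧
        Filter.Tendsto (fun n : ℕ => factorialMoment γ δ r n) Filter.atTop
          (nhds (∫ z in slicedCube γ δ r, 1 / ∏ i, z i)) :=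
    fun h => ⟨integrableOn_slicedCube h δ r, tendsto_factorialMoment h δ r⟩
  refine ⟨?_, hpos⟩
  rcases hγ.eq_or_lt with rfl | hγ0
  · rcases eq_or_ne r 0 with rfl | hr
    · simp [factorialMoment_zero, slicedCube_zero, MeasureTheory.volume_pi]
    · rw [lintegral_slicedCube_zero_left hγδ hδ hr]
      exact ENNReal.tendsto_ofReal_atTop.comp (tendsto_factorialMoment_zero_left hγδ hδ hr)
  · obtain ⟨hint, hlim⟩ := hpos hγ0
    rw [← MeasureTheory.ofReal_integral_eq_lintegral_ofReal hint]
    · exact ENNReal.tendsto_ofReal hlim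
    · filter_upwards [MeasureTheory.ae_restrict_mem (isClosed_slicedCube γ δ r).measurableSet]
        with z hz
      exact one_div_nonneg.2 (Finset.prod_nonneg fun i _ => hγ.trans (hz.1 i).1)
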